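/- A proper closed convex function $h:\mathbb{R}^d\to\mathbb{R}\cup\{\infty\}$, with domain $\operatorname{dom} h=\{x: h(x)<\infty\}$, is called \emph{essentially smooth} if $\operatorname{int}(\operatorname{dom} h)\neq\emptyset$, $h$ is differentiable on $\operatorname{int}(\operatorname{dom} h)$, and $\|\nabla h(x_i)\|\to\infty$ whenever $(x_i)$ is a sequence in $\operatorname{int}(\operatorname{dom} h)$ converging to a point of the boundary of $\operatorname{int}(\operatorname{dom} h)$. It is called \emph{Legendre convex} if in addition it is strictly convex on $\operatorname{int}(\operatorname{dom} h)$. For $x,y$ in $\operatorname{dom} h$ let $D_h(x,y)=h(x)-h(y)-h'(y;x-y)$, where $h'(y;v)=\lim_{\epsilon\downarrow 0}\bigl(h(y+\epsilon v)-h(y)\bigr)/\epsilon$ (so $D_h(x,y)=h(x)-h(y)-\langle\nabla h(y),x-y\rangle$ if $h$ is differentiable at $y$). **Proposition.** Let $f:\mathbb{R}^d\to\mathbb{R}\cup\{\infty\}$ be essentially smooth, and $C^2$ on $\operatorname{int}(\operatorname{dom} f)$. Let $k:\mathbb{R}^d\to\mathbb{R}\cup\{\infty\}$ be Legendre convex,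 and $C^2$ on $\operatorname{int}(\operatorname{dom} k)$. Let $L^*\in\mathbb{R}$. If $\nabla f(\operatorname{int}(\operatorname{dom} f))\subseteq\operatorname{int}(\operatorname{dom} k)$, $\det\nabla^2 k(x^*)\neq 0$ for all $x^*\in\operatorname{int}(\operatorname{dom} k)$, and $$\nabla^2 f(x)\preceq L^*\,[\nabla^2 k(\nabla f(x))]^{-1}\qquad\text{for all }x\in\operatorname{int}(\operatorname{dom} f),$$ where $A\preceq B$ means that $B-A$ is positive semidefinite, then $$D_k(\nabla f(y),\nabla f(x))\le L^*\,D_f(x,y)\qquad\text{for all }x,y\in\operatorname{int}(\operatorname{dom} f).$$ -/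

import Mathlib

open Set Filter Topology

namespace DualPrecond

/-- The effective domain of an extended-real-valued function. -/
def dom {d : ℕ} (h : EuclideanSpace ℝ (Fin d) → EReal) : Set (EuclideanSpace ℝ (Fin d)) :=
  {x | h x < ⊤}

/-- The real-valued function that agrees with `h` wherever `h` is finite. -/
noncomputable def realValued {d : ℕ} (h : EuclideanSpace ℝ (Fin d) → EReal) :
    EuclideanSpace ℝ (Fin d) → ℝ :=
  fun x => (h x).toReal

/-- The gradient of `h`, meaningful at interior points of the domain. -/
noncomputable def grad {d : ℕ} (h : EuclideanSpace ℝ (Fin d) → EReal)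
    (x : EuclideanSpace ℝ (Fin d)) : EuclideanSpace ℝ (Fin d) :=
  gradient (realValued h) x

/-- The Hessian of `h`, as the linear operator `∇²h(x)` on Euclidean space: the derivative of the
gradient map. Its matrix in the standard basis is the matrix of second-order partial derivatives. -/
noncomputable def hess {d : ℕ} (h : EuclideanSpace ℝ (Fin d) → EReal)
    (x : EuclideanSpace ℝ (Fin d)) :
    EuclideanSpace ℝ (Fin d) →L[ℝ] EuclideanSpace ℝ (Fin d) :=
  fderiv ℝ (grad h) x

/-- `h : ℝᵈ → ℝ ∪ {∞}` is a proper closed convex function: it never takes the value `-∞`, is finite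
somewhere, is lower semicontinuous, and has a convex epigraph. -/
structure ProperClosedConvex {d : ℕ} (h : EuclideanSpace ℝ (Fin d) → EReal) : Prop where
  ne_bot : ∀ x, h x ≠ ⊥
  dom_nonempty : (dom h).Nonempty
  lsc : LowerSemicontinuous h
  convex_epigraph : Convex ℝ {p : EuclideanSpace ℝ (Fin d) × ℝ | h p.1 ≤ (p.2 : EReal)}

/-- Essentially smooth (proper closed convex) functions. -/
structure EssentiallySmooth {d : ℕ} (h : EuclideanSpace ℝ (Fin d) → EReal) : Prop
    extends ProperClosedConvex h where
  interior_nonempty : (interior (dom h)).Nonempty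
  differentiable : ∀ x ∈ interior (dom h), DifferentiableAt ℝ (realValued h) x
  grad_blowup : ∀ (u : ℕ → EuclideanSpace ℝ (Fin d)) (b : EuclideanSpace ℝ (Fin d)),
    (∀ i, u i ∈ interior (dom h)) → b ∈ frontier (interior (dom h)) → Tendsto u atTop (𝓝 b) →
      Tendsto (fun i => ‖grad h (u i)‖) atTop atTop

/-- Legendre convex functions: essentially smooth and strictly convex on the interior of the
domain. -/
structure LegendreConvex {d : ℕ} (h : EuclideanSpace ℝ (Fin d) → EReal) : Prop
    extends EssentiallySmooth h where
  strictConvex : StrictConvexOn ℝ (interior (dom h)) (realValued h)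

/-- The one-sided directional derivative `h'(x; v) = lim_{ε ↓ 0} (h(x + εv) - h(x)) / ε`. -/
noncomputable def dirDeriv {d : ℕ} (h : EuclideanSpace ℝ (Fin d) → EReal)
    (x v : EuclideanSpace ℝ (Fin d)) : EReal :=
  limUnder (𝓝[>] (0 : ℝ)) (fun ε : ℝ => (h (x + ε • v) - h x) / (ε : EReal))

/-- The (generalized) Bregman divergence `D_h(x, y) = h(x) - h(y) - h'(y; x - y)`. -/
noncomputable def bregman {d : ℕ} (h : EuclideanSpace ℝ (Fin d) → EReal)
    (x y : EuclideanSpace ℝ (Fin d)) : EReal :=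
  h x - h y - dirDeriv h y (x - y)

end DualPrecond

/-!
The idea is to pass to the conjugate `f*`. With `a = ∇f(x)`, `b = ∇f(y)`, the number `D_f(x, y)` is
the gap at `b` between `f*` and its tangent at `a` with slope `x`, and, formally, the hypothesis
reads `∇²k ≼ L ∇²f*`, so that `L f* - k` is convex along the segment from `a` to `b` and the claim
is the tangent inequality for it. Since `f` need not be strictly convex, `f*` need not be
differentiable and the segment need not lie in the range of `∇f`, so `f` is regularized.

For `ε > 0`, let `Z v` solve `∇f(Z v) + ε (Z v - x) = v`. The solution exists for every `v`: it is
the minimizer of `f + (ε/2) ‖· - x‖² - ⟪v, ·⟫`, which lies in the interior of the domain because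
the gradient of `f` blows up at the boundary (`EssentiallySmooth.mem_interior_of_forall_le`,
`EssentiallySmooth.exists_grad_add_smul_eq`). By strong monotonicity `Z` is unique and Lipschitz, so
it is differentiable with derivative `(∇²f(Z v) + ε)⁻¹` (`EssentiallySmooth.exists_resolvent`), and
`Z a = x`. The conjugate `G` of the regularized function then satisfies `∇G = Z` and
`∇²G(v) = (∇²f(Z v) + ε)⁻¹`.

Two facts make the limit `ε → 0` work without any bound on `Z`.
* A Cauchy–Schwarz argument gives `∇²k(u) ≼ (L + ε ‖∇²k(u)‖) ∇²G(v)` with `u = ∇f(Z v)`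
  (`inner_map_le_of_add_smul_eq`).
* For `v` on the segment from `a` to `b`, `ε ‖Z v - x‖² ≤ D_f(x, y)`, so that
  `‖u - v‖ = ε ‖Z v - x‖` is at most `√(ε D_f(x, y))`, uniformly in `v`.

By continuity of `∇²k` near the compact segment, `∇²k(v) ≼ (L + ε β) ∇²G(v) + δ`, and the tangent
inequality for `(L + ε β) G - k + (δ/2) ‖· - a‖²` along the segment
(`bregman_le_add_of_hess_close`) yields the claim as `ε → 0` and then `δ → 0` (`bregman_real_le`).
-/

namespace DualPrecond

/-! ### Gradients and Hessians of smooth convex functions -/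

section Calculus

variable {E : Type*} [NormedAddCommGroup E] [InnerProductSpace ℝ E]

theorem _root_.HasGradientAt.comp_hasDerivAt [CompleteSpace E] {g : E → ℝ} {g' c' : E} {c : ℝ → E}
    {t : ℝ} (hg : HasGradientAt g g' (c t)) (hc : HasDerivAt c c' t) :
    HasDerivAt (fun s => g (c s)) (inner ℝ g' c') t := by
  have h := hg.hasFDerivAt.comp_hasDerivAt t hc
  rwa [InnerProductSpace.toDual_apply_apply] at h

theorem hasDerivAt_add_smul (x v : E) (t : ℝ) : HasDerivAt (fun s : ℝ => x + s • v) v t := by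
  simpa using ((hasDerivAt_id t).smul_const v).const_add x

/-- The gradient inequality for convex functions. -/
theorem _root_.ConvexOn.add_inner_le [CompleteSpace E] {s : Set E} {g : E → ℝ} {g' x z : E}
    (hg : ConvexOn ℝ s g) (hx : HasGradientAt g g' x) (hxs : x ∈ s) (hz : z ∈ s) :
    g x + inner ℝ g' (z - x) ≤ g z := by
  have h1 := hg.comp_affineMap (AffineMap.lineMap x z : ℝ →ᵃ[ℝ] E)
  have hc : HasDerivAt (AffineMap.lineMap x z : ℝ → E) (z - x) 0 := AffineMap.hasDerivAt_lineMap
  have hd : HasDerivAt (g ∘ (AffineMap.lineMap x z : ℝ →ᵃ[ℝ] E)) (inner ℝ g' (z - x)) 0 :=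
    HasGradientAt.comp_hasDerivAt (by simpa using hx) hc
  have := h1.le_slope_of_hasDerivAt (x := 0) (y := 1) (by simpa using hxs) (by simpa using hz)
    one_pos hd
  simp [slope_def_field] at this
  linarith

theorem _root_.ConvexOn.inner_gradient_sub_nonneg [CompleteSpace E] {s : Set E} {g : E → ℝ}
    {p q x z : E} (hg : ConvexOn ℝ s g) (hx : HasGradientAt g p x) (hz : HasGradientAt g q z)
    (hxs : x ∈ s) (hzs : z ∈ s) : 0 ≤ inner ℝ (q - p) (z - x) := by
  have h1 := hg.add_inner_le hx hxs hzs
  have h2 := hg.add_inner_le hz hzs hxs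
  rw [← neg_sub z x, inner_neg_right] at h2
  rw [inner_sub_left]
  linarith

section Hessian

variable [CompleteSpace E] {U : Set E} {g : E → ℝ} {x : E}

theorem _root_.ContDiffOn.hasGradientAt (hg : ContDiffOn ℝ 2 g U) (hU : IsOpen U) (hx : x ∈ U) :
    HasGradientAt g (gradient g x) x :=
  ((hg.contDiffAt (hU.mem_nhds hx)).differentiableAt (by norm_num)).hasGradientAt

theorem _root_.ContDiffOn.contDiffOn_gradient (hg : ContDiffOn ℝ 2 g U) (hU : IsOpen U) :
    ContDiffOn ℝ 1 (gradient g) U :=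
  (InnerProductSpace.toDual ℝ E).symm.contDiff.comp_contDiffOn
    (hg.fderiv_of_isOpen hU (by norm_num))

theorem _root_.ContDiffOn.hasFDerivAt_gradient (hg : ContDiffOn ℝ 2 g U) (hU : IsOpen U)
    (hx : x ∈ U) : HasFDerivAt (gradient g) (fderiv ℝ (gradient g) x) x :=
  (((hg.contDiffOn_gradient hU).contDiffAt (hU.mem_nhds hx)).differentiableAt
    (by norm_num)).hasFDerivAt

theorem _root_.ContDiffOn.continuousAt_fderiv_gradient (hg : ContDiffOn ℝ 2 g U) (hU : IsOpen U)
    (hx : x ∈ U) : ContinuousAt (fderiv ℝ (gradient g)) x :=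
  ((hg.contDiffOn_gradient hU).continuousOn_fderiv_of_isOpen hU le_rfl).continuousAt
    (hU.mem_nhds hx)

/-- The Hessian of a `C²` function is symmetric. -/
theorem _root_.ContDiffOn.inner_fderiv_gradient_comm (hg : ContDiffOn ℝ 2 g U) (hU : IsOpen U)
    (hx : x ∈ U) (u v : E) :
    inner ℝ (fderiv ℝ (gradient g) x u) v = inner ℝ u (fderiv ℝ (gradient g) x v) := by
  have hF : HasFDerivAt (fderiv ℝ g) (fderiv ℝ (fderiv ℝ g) x) x :=
    (((hg.fderiv_of_isOpen hU (by norm_num)).contDiffAt (hU.mem_nhds hx)).differentiableAt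
      (n := 1) (by norm_num)).hasFDerivAt
  have hsymm := second_derivative_symmetric_of_eventually_of_real
    (by filter_upwards [hU.mem_nhds hx] with z hz
        exact (hg.hasGradientAt hU hz).differentiableAt.hasFDerivAt) hF
  have key : ∀ u v, inner ℝ (fderiv ℝ (gradient g) x u) v = fderiv ℝ (fderiv ℝ g) x u v := by
    intro u v
    have h1 := (hg.hasFDerivAt_gradient hU hx).inner ℝ (hasFDerivAt_const v x)
    have h2 := hF.clm_apply (hasFDerivAt_const v x)
    simp only [inner_gradient_left] at h1
    simpa using congrArg (fun l : E →L[ℝ] ℝ => l u) (h1.unique h2)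
  rw [key, real_inner_comm, key, hsymm]

theorem _root_.ConvexOn.inner_fderiv_gradient_nonneg (hc : ConvexOn ℝ U g)
    (hg : ContDiffOn ℝ 2 g U) (hU : IsOpen U) (hx : x ∈ U) (v : E) :
    0 ≤ inner ℝ (fderiv ℝ (gradient g) x v) v := by
  have hline := hasDerivAt_add_smul x v 0
  have hd : HasDerivAt (fun t : ℝ => gradient g (x + t • v)) (fderiv ℝ (gradient g) x v) 0 := by
    have hF : HasFDerivAt (gradient g) (fderiv ℝ (gradient g) x) (x + (0 : ℝ) • v) := by
      simpa using hg.hasFDerivAt_gradient hU hx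
    exact hF.comp_hasDerivAt (0 : ℝ) hline
  have hd2 : HasDerivAt (fun t : ℝ => inner ℝ (gradient g (x + t • v)) v)
      (inner ℝ (fderiv ℝ (gradient g) x v) v) 0 := by
    simpa using hd.inner ℝ (hasDerivAt_const (0 : ℝ) v)
  have hlim := (hasDerivAt_iff_tendsto_slope.1 hd2).mono_left
    (nhdsWithin_mono (0 : ℝ) (fun t (ht : 0 < t) => ht.ne') : 𝓝[>] (0 : ℝ) ≤ _)
  refine ge_of_tendsto hlim ?_
  have hmem : ∀ᶠ t in 𝓝[>] (0 : ℝ), x + t • v ∈ U :=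
    nhdsWithin_le_nhds (hline.continuousAt.eventually_mem (by simpa using hU.mem_nhds hx))
  filter_upwards [hmem, self_mem_nhdsWithin] with t ht (htpos : 0 < t)
  have h1 := hc.inner_gradient_sub_nonneg (hg.hasGradientAt hU hx) (hg.hasGradientAt hU ht) hx ht
  rw [add_sub_cancel_left, inner_smul_right, inner_sub_left] at h1
  have h2 := nonneg_of_mul_nonneg_right h1 htpos
  simp only [slope_def_field, zero_smul, add_zero, sub_zero]
  positivity

end Hessian

/-! ### Positive semidefinite operators -/

/-- The Cauchy–Schwarz inequality for the semi-inner product of a positive semidefinite operator. -/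
theorem sq_inner_map_le {T : E →L[ℝ] E} (hsymm : ∀ u v, inner ℝ (T u) v = inner ℝ u (T v))
    (hpos : ∀ u, 0 ≤ inner ℝ (T u) u) (u v : E) :
    inner ℝ (T u) v ^ 2 ≤ inner ℝ (T u) u * inner ℝ (T v) v := by
  have h := discrim_le_zero (a := inner ℝ (T u) u) (b := 2 * inner ℝ (T u) v)
    (c := inner ℝ (T v) v) fun t => by
      have := hpos (t • u + v)
      simp only [map_add, map_smul, inner_add_left, inner_add_right, inner_smul_left,
        inner_smul_right, RCLike.conj_to_real] at this
      have h2 : inner ℝ (T v) u = inner ℝ (T u) v := by rw [hsymm v u, real_inner_comm]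
      rw [h2] at this
      linarith
  rw [discrim] at h
  linarith

theorem sq_norm_map_le {T : E →L[ℝ] E} (hsymm : ∀ u v, inner ℝ (T u) v = inner ℝ u (T v))
    (hpos : ∀ u, 0 ≤ inner ℝ (T u) u) (u : E) : ‖T u‖ ^ 2 ≤ ‖T‖ * inner ℝ (T u) u := by
  have h1 := sq_inner_map_le hsymm hpos u (T u)
  rw [real_inner_self_eq_norm_sq] at h1
  have h2 : inner ℝ (T (T u)) (T u) ≤ ‖T‖ * ‖T u‖ ^ 2 := by
    refine (real_inner_le_norm _ _).trans ?_
    have := mul_le_mul_of_nonneg_right (T.le_opNorm (T u)) (norm_nonneg (T u))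
    linarith
  rcases eq_or_ne (T u) 0 with h0 | h0
  · simp [h0]
  · have h3 : 0 < ‖T u‖ ^ 2 := by positivity
    refine le_of_mul_le_mul_right ?_ h3
    nlinarith [mul_le_mul_of_nonneg_left h2 (hpos u)]

/-- If `A ≼ L • B⁻¹`, expressed without the inverse as a bound on the range of `B`, then
`B ≼ (L + ε‖B‖) • (A + ε)⁻¹`. The vector `s` plays the role of `(A + ε)⁻¹ w`. -/
theorem inner_map_le_of_add_smul_eq {A B : E →L[ℝ] E} {L ε β : ℝ} {s w : E}
    (hAsymm : ∀ u v, inner ℝ (A u) v = inner ℝ u (A v)) (hApos : ∀ u, 0 ≤ inner ℝ (A u) u)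
    (hBsymm : ∀ u v, inner ℝ (B u) v = inner ℝ u (B v)) (hBpos : ∀ u, 0 ≤ inner ℝ (B u) u)
    (hAB : ∀ u, inner ℝ (A (B u)) (B u) ≤ L * inner ℝ (B u) u)
    (hL : 0 ≤ L) (hε : 0 ≤ ε) (hβ : ‖B‖ ≤ β) (hs : A s + ε • s = w) :
    inner ℝ (B w) w ≤ (L + ε * β) * inner ℝ s w := by
  let T : E →L[ℝ] E := A + ε • ContinuousLinearMap.id ℝ E
  have hT : ∀ u, T u = A u + ε • u := fun u => by simp [T]
  have hTsymm : ∀ u v, inner ℝ (T u) v = inner ℝ u (T v) := fun u v => by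
    simp [hT, inner_add_left, inner_add_right, inner_smul_left, inner_smul_right, hAsymm]
  have hTpos : ∀ u, 0 ≤ inner ℝ (T u) u := fun u => by
    rw [hT, inner_add_left, real_inner_smul_left, real_inner_self_eq_norm_sq]
    have := hApos u
    positivity
  have hTs : T s = w := (hT s).trans hs
  have hβ0 : 0 ≤ β := (norm_nonneg B).trans hβ
  have hcs := sq_inner_map_le hTsymm hTpos s (B w)
  have hsw : 0 ≤ inner ℝ w s := hTs ▸ hTpos s
  have hTB : inner ℝ (T (B w)) (B w) ≤ (L + ε * β) * inner ℝ (B w) w := by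
    rw [hT, inner_add_left, real_inner_smul_left, real_inner_self_eq_norm_sq]
    have h1 := sq_norm_map_le hBsymm hBpos w
    have h2 := mul_le_mul_of_nonneg_right hβ (hBpos w)
    nlinarith [hAB w, mul_le_mul_of_nonneg_left (h1.trans h2) hε]
  rw [hTs, real_inner_comm (B w) w] at hcs
  rw [real_inner_comm w s]
  rcases (hBpos w).eq_or_lt with h0 | h0
  · rw [← h0]
    positivity
  · refine le_of_mul_le_mul_right ?_ h0
    nlinarith [mul_le_mul_of_nonneg_left hTB hsw]

end Calculus

/-! ### Extended-real-valued convex functions -/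

section ExtendedReal

variable {d : ℕ} {h : EuclideanSpace ℝ (Fin d) → EReal} {x y z : EuclideanSpace ℝ (Fin d)}

theorem ProperClosedConvex.coe_realValued (hh : ProperClosedConvex h) (hx : x ∈ dom h) :
    (realValued h x : EReal) = h x :=
  EReal.coe_toReal (ne_of_lt hx) (hh.ne_bot x)

theorem ProperClosedConvex.convexOn (hh : ProperClosedConvex h) :
    ConvexOn ℝ (dom h) (realValued h) := by
  have key : ∀ ⦃x⦄, x ∈ dom h → ∀ ⦃y⦄, y ∈ dom h → ∀ ⦃a b : ℝ⦄, 0 ≤ a → 0 ≤ b → a + b = 1 →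
      h (a • x + b • y) ≤ ((a • realValued h x + b • realValued h y : ℝ) : EReal) := by
    intro x hx y hy a b ha hb hab
    have hx' : (x, realValued h x) ∈
        {p : EuclideanSpace ℝ (Fin d) × ℝ | h p.1 ≤ (p.2 : EReal)} := (hh.coe_realValued hx).ge
    have hy' : (y, realValued h y) ∈
        {p : EuclideanSpace ℝ (Fin d) × ℝ | h p.1 ≤ (p.2 : EReal)} := (hh.coe_realValued hy).ge
    exact hh.convex_epigraph hx' hy' ha hb hab
  have hconv : Convex ℝ (dom h) := fun x hx y hy a b ha hb hab =>
    (key hx hy ha hb hab).trans_lt (EReal.coe_lt_top _)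
  refine ⟨hconv, fun x hx y hy a b ha hb hab => ?_⟩
  have h1 := key hx hy ha hb hab
  rwa [← hh.coe_realValued (hconv hx hy ha hb hab), EReal.coe_le_coe_iff] at h1

theorem ProperClosedConvex.dirDeriv_eq (hh : ProperClosedConvex h) (hy : y ∈ interior (dom h))
    (hd : DifferentiableAt ℝ (realValued h) y) (v : EuclideanSpace ℝ (Fin d)) :
    dirDeriv h y v = ((inner ℝ (grad h y) v : ℝ) : EReal) := by
  refine Tendsto.limUnder_eq ?_
  have hline := hasDerivAt_add_smul y v 0
  have hderiv : HasDerivAt (fun t : ℝ => realValued h (y + t • v)) (inner ℝ (grad h y) v) 0 :=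
    HasGradientAt.comp_hasDerivAt (by simpa [grad] using hd.hasGradientAt) hline
  have hlim := (hasDerivAt_iff_tendsto_slope.1 hderiv).mono_left
    (nhdsWithin_mono (0 : ℝ) (fun t (ht : 0 < t) => ht.ne') : 𝓝[>] (0 : ℝ) ≤ _)
  have hmem : ∀ᶠ t in 𝓝[>] (0 : ℝ), y + t • v ∈ interior (dom h) :=
    nhdsWithin_le_nhds (hline.continuousAt.eventually_mem
      (by simpa using isOpen_interior.mem_nhds hy))
  refine ((continuous_coe_real_ereal.tendsto _).comp hlim).congr' ?_
  filter_upwards [hmem] with t ht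
  rw [← hh.coe_realValued (interior_subset ht), ← hh.coe_realValued (interior_subset hy),
    ← EReal.coe_sub, ← EReal.coe_div]
  simp [slope_def_field]

theorem ProperClosedConvex.bregman_eq (hh : ProperClosedConvex h) (hx : x ∈ dom h)
    (hy : y ∈ interior (dom h)) (hd : DifferentiableAt ℝ (realValued h) y) :
    bregman h x y =
      ((realValued h x - realValued h y - inner ℝ (grad h y) (x - y) : ℝ) : EReal) := by
  rw [bregman, hh.dirDeriv_eq hy hd, ← hh.coe_realValued hx,
    ← hh.coe_realValued (interior_subset hy)]
  norm_cast

/-! ### The proximal equation for essentially smooth functions -/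

theorem hasGradientAt_quadratic {E : Type*} [NormedAddCommGroup E] [InnerProductSpace ℝ E]
    [CompleteSpace E] (ε : ℝ) (v x z : E) :
    HasGradientAt (fun u => ε / 2 * ‖u - x‖ ^ 2 - inner ℝ v u) (ε • (z - x) - v) z := by
  rw [hasGradientAt_iff_hasFDerivAt]
  have h1 := (((hasFDerivAt_id z).sub_const x).norm_sq.const_mul (ε / 2)).sub
    (innerSL ℝ v).hasFDerivAt
  refine h1.congr_fderiv ?_
  ext u
  simp
  ring

/-- A closed convex function plus a strictly convex quadratic attains its minimum: outside a ball
around `x` the quadratic term dominates an affine minorant that is exact at `x`. -/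
theorem ProperClosedConvex.exists_forall_add_quadratic_le (hh : ProperClosedConvex h)
    {g : EuclideanSpace ℝ (Fin d)} (hx : x ∈ dom h)
    (hg : ∀ z ∈ dom h, realValued h x + inner ℝ g (z - x) ≤ realValued h z)
    {ε : ℝ} (hε : 0 < ε) (v : EuclideanSpace ℝ (Fin d)) :
    ∃ z ∈ dom h, ∀ u ∈ dom h,
      realValued h z + (ε / 2 * ‖z - x‖ ^ 2 - inner ℝ v z) ≤
        realValued h u + (ε / 2 * ‖u - x‖ ^ 2 - inner ℝ v u) := by
  set q : EuclideanSpace ℝ (Fin d) → ℝ := fun u => ε / 2 * ‖u - x‖ ^ 2 - inner ℝ v u with hq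
  have hqc : Continuous q := by fun_prop
  have hlsc : LowerSemicontinuous fun u => h u + (q u : EReal) := by
    refine hh.lsc.add' (continuous_coe_real_ereal.comp hqc).lowerSemicontinuous fun u => ?_
    exact EReal.continuousAt_add (Or.inr (EReal.coe_ne_bot _)) (Or.inr (EReal.coe_ne_top _))
  set R : ℝ := 2 * ‖g - v‖ / ε with hR
  have hR0 : 0 ≤ R := by positivity
  have hxR : x ∈ Metric.closedBall x R := Metric.mem_closedBall_self hR0
  obtain ⟨z, -, hz⟩ := (hlsc.lowerSemicontinuousOn (Metric.closedBall x R)).exists_isMinOn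
    ⟨x, hxR⟩ (isCompact_closedBall x R)
  have hcoe : ∀ u ∈ dom h, h u + (q u : EReal) = ((realValued h u + q u : ℝ) : EReal) :=
    fun u hu => by rw [← hh.coe_realValued hu, EReal.coe_add]
  have hzdom : z ∈ dom h := by
    have h1 : h z + (q z : EReal) ≤ h x + (q x : EReal) := hz hxR
    rw [hcoe x hx] at h1
    by_contra hcon
    have h2 : h z = ⊤ := not_lt_top_iff.1 hcon
    rw [h2, EReal.top_add_coe] at h1
    exact absurd h1 (not_le.2 (EReal.coe_lt_top _))
  have hball : ∀ u ∈ dom h, u ∈ Metric.closedBall x R →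
      realValued h z + q z ≤ realValued h u + q u := fun u hu huR => by
    have h1 : h z + (q z : EReal) ≤ h u + (q u : EReal) := hz huR
    rwa [hcoe z hzdom, hcoe u hu, EReal.coe_le_coe_iff] at h1
  refine ⟨z, hzdom, fun u hu => ?_⟩
  by_cases huR : u ∈ Metric.closedBall x R
  · exact hball u hu huR
  · refine (hball x hx hxR).trans ?_
    rw [Metric.mem_closedBall, dist_eq_norm, not_le, hR, div_lt_iff₀ hε] at huR
    have h1 := hg u hu
    have h2 : -(‖g - v‖ * ‖u - x‖) ≤ inner ℝ (g - v) (u - x) :=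
      neg_le_of_abs_le (abs_real_inner_le_norm _ _)
    have h3 : inner ℝ (g - v) (u - x) = inner ℝ g (u - x) - (inner ℝ v u - inner ℝ v x) := by
      rw [inner_sub_left, inner_sub_right v]
    have h4 := mul_le_mul_of_nonneg_right huR.le (norm_nonneg (u - x))
    simp only [hq, sub_self, norm_zero]
    nlinarith

/-- The blow-up of the gradient of an essentially smooth function keeps minimizers of smooth
perturbations away from the boundary: along a segment from a boundary point into the interior, the
slope tends to `-∞`. -/
theorem EssentiallySmooth.mem_interior_of_forall_le (hh : EssentiallySmooth h)
    {q : EuclideanSpace ℝ (Fin d) → ℝ} (hq : DifferentiableAt ℝ q z) (hz : z ∈ dom h)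
    (hmin : ∀ u ∈ dom h, realValued h z + q z ≤ realValued h u + q u) :
    z ∈ interior (dom h) := by
  by_contra hzint
  have hconv := hh.toProperClosedConvex.convexOn
  obtain ⟨p, hp⟩ := hh.interior_nonempty
  set c : ℕ → ℝ := fun i => 1 / ((i : ℝ) + 1) with hc
  have hc0 : Tendsto c atTop (𝓝 0) := tendsto_one_div_add_atTop_nhds_zero_nat
  have hcpos : ∀ i, 0 < c i := fun i => by positivity
  have hcle : ∀ i, c i ≤ 1 := fun i => by
    rw [hc]
    exact (div_le_one (by positivity)).2 (by linarith [(Nat.cast_nonneg i : (0 : ℝ) ≤ i)])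
  set u : ℕ → EuclideanSpace ℝ (Fin d) := fun i => z + c i • (p - z) with hu
  have humem : ∀ i, u i ∈ interior (dom h) := fun i =>
    hconv.1.add_smul_sub_mem_interior hz hp ⟨hcpos i, hcle i⟩
  have hulim : Tendsto u atTop (𝓝 z) := by
    simpa using (hc0.smul_const (p - z)).const_add z
  have hfront : z ∈ frontier (interior (dom h)) := by
    rw [frontier, interior_interior]
    exact ⟨mem_closure_of_tendsto hulim (Eventually.of_forall humem), hzint⟩
  have hblow := hh.grad_blowup u z humem hfront hulim
  have hgrad : ∀ w ∈ interior (dom h), HasGradientAt (realValued h) (grad h w) w :=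
    fun w hw => (hh.differentiable w hw).hasGradientAt
  -- `h` is bounded above by `h p + 1` on a ball of radius `2 r` around `p`.
  obtain ⟨r, hr, hball⟩ : ∃ r > 0, ∀ w, dist w p < 2 * r →
      w ∈ dom h ∧ realValued h w < realValued h p + 1 := by
    have h1 : ∀ᶠ w in 𝓝 p, w ∈ dom h ∧ realValued h w < realValued h p + 1 :=
      Filter.Eventually.and (mem_interior_iff_mem_nhds.1 hp)
        ((hh.differentiable p hp).continuousAt.eventually_lt continuousAt_const (by simp))
    obtain ⟨r, hr, h2⟩ := Metric.eventually_nhds_iff.1 h1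
    exact ⟨r / 2, by positivity, fun w hw => h2 (by linarith)⟩
  -- The difference quotients of `q` along the segment stay bounded.
  obtain ⟨K, hK⟩ : ∃ K : ℝ, ∀ᶠ i in atTop, q (u i) - q z ≤ c i * K := by
    have h1 : HasDerivAt (fun t : ℝ => q (z + t • (p - z))) (fderiv ℝ q z (p - z)) 0 := by
      have h2 : HasFDerivAt q (fderiv ℝ q z) (z + (0 : ℝ) • (p - z)) := by
        simpa using hq.hasFDerivAt
      exact h2.comp_hasDerivAt (0 : ℝ) (hasDerivAt_add_smul z (p - z) 0)
    have h3 : Tendsto c atTop (𝓝[≠] 0) :=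
      tendsto_nhdsWithin_iff.2 ⟨hc0, Eventually.of_forall fun i => (hcpos i).ne'⟩
    have h4 := (hasDerivAt_iff_tendsto_slope.1 h1).comp h3
    refine ⟨fderiv ℝ q z (p - z) + 1, ?_⟩
    filter_upwards [h4.eventually_lt_const (lt_add_one _)] with i hi
    simp only [Function.comp, slope_def_field, sub_zero, zero_smul, add_zero] at hi
    rw [div_lt_iff₀ (hcpos i)] at hi
    rw [mul_comm]
    exact hi.le
  obtain ⟨i, hKi, hbig⟩ := (hK.and (hblow.eventually_gt_atTop
    (max 0 ((realValued h p + 1 - realValued h z + 2 * |K|) / r)))).exists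
  set g := grad h (u i) with hgdef
  have hg0 : 0 < ‖g‖ := (le_max_left _ _).trans_lt hbig
  have hgbig : realValued h p + 1 - realValued h z + 2 * |K| < ‖g‖ * r :=
    (div_lt_iff₀ hr).1 ((le_max_right _ _).trans_lt hbig)
  have hmini := hmin (u i) (interior_subset (humem i))
  -- The gradient inequality at `u i`, evaluated at `z`.
  have hslope : realValued h (u i) - c i * inner ℝ g (p - z) ≤ realValued h z := by
    have h1 := hconv.add_inner_le (hgrad _ (humem i)) (interior_subset (humem i)) hz
    have h2 : z - u i = -(c i • (p - z)) := by simp [hu]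
    rw [h2, inner_neg_right, inner_smul_right] at h1
    linarith
  have hlow : -K ≤ inner ℝ g (p - z) := by
    refine le_of_mul_le_mul_left ?_ (hcpos i)
    linarith
  -- The gradient inequality at `u i`, evaluated at a point displaced from `p` in the direction `g`,
  -- produces the term `r * ‖g‖` that has to stay bounded.
  have hup : realValued h (u i) + (1 - c i) * inner ℝ g (p - z) + r * ‖g‖ ≤
      realValued h p + 1 := by
    have hw := hball (p + (r / ‖g‖) • g) (by
      rw [dist_eq_norm, add_sub_cancel_left, norm_smul, Real.norm_of_nonneg (by positivity),
        div_mul_cancel₀ _ hg0.ne']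
      linarith)
    have h1 := hconv.add_inner_le (hgrad _ (humem i)) (interior_subset (humem i)) hw.1
    have h2 : p + (r / ‖g‖) • g - u i = (1 - c i) • (p - z) + (r / ‖g‖) • g := by
      simp only [hu]
      module
    rw [h2, inner_add_right, inner_smul_right, inner_smul_right, real_inner_self_eq_norm_sq] at h1
    have h3 : r / ‖g‖ * ‖g‖ ^ 2 = r * ‖g‖ := by field_simp
    linarith [hw.2]
  have h1 : c i * K ≤ |K| := by
    nlinarith [le_abs_self K, abs_nonneg K, hcpos i, hcle i]
  have h2 : -|K| ≤ (1 - c i) * inner ℝ g (p - z) := by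
    nlinarith [le_abs_self K, abs_nonneg K, hcpos i, hcle i]
  linarith

/-- The gradient map of an essentially smooth function satisfies the range condition: the
regularized equation `∇h(z) + ε (z - x) = v` is solvable in the interior of the domain. -/
theorem EssentiallySmooth.exists_grad_add_smul_eq (hh : EssentiallySmooth h)
    (hx : x ∈ interior (dom h)) {ε : ℝ} (hε : 0 < ε) (v : EuclideanSpace ℝ (Fin d)) :
    ∃ z ∈ interior (dom h), grad h z + ε • (z - x) = v := by
  have hxg : HasGradientAt (realValued h) (grad h x) x := (hh.differentiable x hx).hasGradientAt
  obtain ⟨z, hz, hmin⟩ := hh.toProperClosedConvex.exists_forall_add_quadratic_le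
    (interior_subset hx)
    (fun z hz => hh.toProperClosedConvex.convexOn.add_inner_le hxg (interior_subset hx) hz) hε v
  have hq := hasGradientAt_quadratic ε v x z
  have hzint := hh.mem_interior_of_forall_le hq.differentiableAt hz hmin
  refine ⟨z, hzint, ?_⟩
  have hzg : HasGradientAt (realValued h) (grad h z) z :=
    (hh.differentiable z hzint).hasGradientAt
  have hloc : IsLocalMin (fun u => realValued h u + (ε / 2 * ‖u - x‖ ^ 2 - inner ℝ v u)) z := by
    filter_upwards [mem_interior_iff_mem_nhds.1 hzint] with u hu
    exact hmin u hu
  have h0 := hloc.hasFDerivAt_eq_zero (hzg.hasFDerivAt.add hq.hasFDerivAt)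
  rw [← map_add] at h0
  have h1 := (InnerProductSpace.toDual ℝ (EuclideanSpace ℝ (Fin d))).map_eq_zero_iff.1 h0
  rw [← sub_eq_zero, ← h1]
  abel

end ExtendedReal

/-! ### The resolvent of the gradient map -/

section Resolvent

variable {d : ℕ} {f : EuclideanSpace ℝ (Fin d) → EReal} {x : EuclideanSpace ℝ (Fin d)}

/-- For essentially smooth `C²` functions `f`, the inverse `Z` of `z ↦ ∇f(z) + ε (z - x)` is
defined on the whole space and differentiable, with derivative `(∇²f(Z v) + ε)⁻¹`. -/
theorem EssentiallySmooth.exists_resolvent (hf : EssentiallySmooth f)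
    (hf2 : ContDiffOn ℝ 2 (realValued f) (interior (dom f))) (hx : x ∈ interior (dom f))
    {ε : ℝ} (hε : 0 < ε) :
    ∃ (Z : EuclideanSpace ℝ (Fin d) → EuclideanSpace ℝ (Fin d))
      (Z' : EuclideanSpace ℝ (Fin d) → EuclideanSpace ℝ (Fin d) →L[ℝ] EuclideanSpace ℝ (Fin d)),
      (∀ v, Z v ∈ interior (dom f)) ∧ (∀ v, grad f (Z v) + ε • (Z v - x) = v) ∧
      Z (grad f x) = x ∧ (∀ v, HasFDerivAt Z (Z' v) v) ∧
      ∀ v w, hess f (Z v) (Z' v w) + ε • Z' v w = w := by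
  have hconv : ConvexOn ℝ (interior (dom f)) (realValued f) :=
    hf.toProperClosedConvex.convexOn.subset interior_subset
      hf.toProperClosedConvex.convexOn.1.interior
  choose Z hZmem hZ using fun v => hf.exists_grad_add_smul_eq hx hε v
  -- Strong monotonicity of `z ↦ ∇f(z) + ε (z - x)` makes it expand distances by at least `ε`.
  have hexp : ∀ z ∈ interior (dom f), ∀ z' ∈ interior (dom f),
      ε * ‖z - z'‖ ≤ ‖(grad f z + ε • (z - x)) - (grad f z' + ε • (z' - x))‖ := by
    intro z hz z' hz'
    rcases eq_or_ne z z' with rfl | hne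
    · simp
    have h1 : 0 ≤ inner ℝ (grad f z - grad f z') (z - z') := hconv.inner_gradient_sub_nonneg
      (hf2.hasGradientAt isOpen_interior hz') (hf2.hasGradientAt isOpen_interior hz) hz' hz
    have h2 : (grad f z + ε • (z - x)) - (grad f z' + ε • (z' - x)) =
        (grad f z - grad f z') + ε • (z - z') := by module
    have h3 := real_inner_le_norm ((grad f z + ε • (z - x)) - (grad f z' + ε • (z' - x))) (z - z')
    rw [h2, inner_add_left, real_inner_smul_left, real_inner_self_eq_norm_sq] at h3
    rw [h2]
    refine le_of_mul_le_mul_right ?_ (norm_pos_iff.2 (sub_ne_zero.2 hne))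
    linarith
  have hZlip : ∀ v v', ‖Z v - Z v'‖ ≤ ε⁻¹ * ‖v - v'‖ := fun v v' => by
    have h1 := hexp _ (hZmem v) _ (hZmem v')
    rw [hZ, hZ] at h1
    rwa [inv_mul_eq_div, le_div_iff₀' hε]
  have hZcont : Continuous Z :=
    (LipschitzWith.of_dist_le_mul (K := (ε⁻¹).toNNReal) fun v v' => by
      rw [dist_eq_norm, dist_eq_norm, Real.coe_toNNReal _ (by positivity)]
      exact hZlip v v').continuous
  have hZx : Z (grad f x) = x := by
    have h1 := hexp _ (hZmem (grad f x)) _ hx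
    rw [hZ, sub_self x, smul_zero, add_zero, sub_self, norm_zero] at h1
    exact sub_eq_zero.1 (norm_le_zero_iff.1 (nonpos_of_mul_nonpos_right h1 hε))
  have hequiv : ∀ v, ∃ e : EuclideanSpace ℝ (Fin d) ≃L[ℝ] EuclideanSpace ℝ (Fin d),
      ∀ u, e u = hess f (Z v) u + ε • u := fun v => by
    let T : EuclideanSpace ℝ (Fin d) →L[ℝ] EuclideanSpace ℝ (Fin d) :=
      hess f (Z v) + ε • ContinuousLinearMap.id ℝ _
    have hT : ∀ u, T u = hess f (Z v) u + ε • u := fun u => by simp [T]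
    have hinj : Function.Injective (T : EuclideanSpace ℝ (Fin d) →ₗ[ℝ] EuclideanSpace ℝ (Fin d)) := by
      refine (injective_iff_map_eq_zero _).2 fun u hu => ?_
      have h1 : inner ℝ (T u) u = 0 := by
        rw [show T u = 0 from hu, inner_zero_left]
      rw [hT, inner_add_left, real_inner_smul_left, real_inner_self_eq_norm_sq] at h1
      have h2 : 0 ≤ inner ℝ (hess f (Z v) u) u :=
        hconv.inner_fderiv_gradient_nonneg hf2 isOpen_interior (hZmem v) u
      have h3 : ε * ‖u‖ ^ 2 ≤ 0 := by linarith
      have h4 := nonpos_of_mul_nonpos_right h3 hε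
      exact norm_eq_zero.1 (pow_eq_zero_iff two_ne_zero |>.1 (le_antisymm h4 (by positivity)))
    exact ⟨(LinearEquiv.ofInjectiveEndo _ hinj).toContinuousLinearEquiv, fun u => hT u⟩
  choose e he using hequiv
  refine ⟨Z, fun v => (e v).symm, hZmem, hZ, hZx, fun v => ?_, fun v w => ?_⟩
  · refine HasFDerivAt.of_local_left_inverse (f := fun z => grad f z + ε • (z - x))
      hZcont.continuousAt ?_ (Eventually.of_forall hZ)
    have h1 : HasFDerivAt (grad f) (hess f (Z v)) (Z v) :=
      hf2.hasFDerivAt_gradient isOpen_interior (hZmem v)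
    refine (h1.add (((hasFDerivAt_id (Z v)).sub_const x).const_smul ε)).congr_fderiv ?_
    ext1 u
    simp [he]
  · have h1 := he v ((e v).symm w)
    rw [ContinuousLinearEquiv.apply_symm_apply] at h1
    exact h1.symm

end Resolvent

/-! ### The Bregman inequality -/

section Bregman

variable {d : ℕ} {f k : EuclideanSpace ℝ (Fin d) → EReal} {x y : EuclideanSpace ℝ (Fin d)}

/-- The regularized inequality. The parameter `δ` bounds the variation of `∇²k` within distance `ρ`
of the segment from `∇f(x)` to `∇f(y)`, and `β` bounds its norm there. -/
theorem bregman_le_add_of_hess_close {L ε β δ ρ : ℝ} (hf : EssentiallySmooth f)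
    (hf2 : ContDiffOn ℝ 2 (realValued f) (interior (dom f))) (hk : ProperClosedConvex k)
    (hk2 : ContDiffOn ℝ 2 (realValued k) (interior (dom k)))
    (hmaps : MapsTo (grad f) (interior (dom f)) (interior (dom k)))
    (hle : ∀ z ∈ interior (dom f), ∀ u,
      inner ℝ (hess f z (hess k (grad f z) u)) (hess k (grad f z) u) ≤
        L * inner ℝ (hess k (grad f z) u) u)
    (hx : x ∈ interior (dom f)) (hy : y ∈ interior (dom f))
    (hL : 0 ≤ L) (hε : 0 < ε) (hβ : 0 ≤ β) (hρ : 0 < ρ)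
    (hclose : ∀ v ∈ segment ℝ (grad f x) (grad f y), ∀ u, ‖u - v‖ < ρ →
      ‖hess k v - hess k u‖ ≤ δ ∧ ‖hess k u‖ ≤ β)
    (hερ : ε * (realValued f x - realValued f y - inner ℝ (grad f y) (x - y)) < ρ ^ 2) :
    realValued k (grad f y) - realValued k (grad f x) -
        inner ℝ (grad k (grad f x)) (grad f y - grad f x) ≤
      (L + ε * β) * (realValued f x - realValued f y - inner ℝ (grad f y) (x - y)) +
        δ / 2 * ‖grad f y - grad f x‖ ^ 2 := by
  obtain ⟨Z, Z', hZmem, hZ, hZx, hZ', hZH⟩ := hf.exists_resolvent hf2 hx hε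
  have hfconv := hf.toProperClosedConvex.convexOn
  have hfconv' := hfconv.subset interior_subset hfconv.1.interior
  have hkconv' := hk.convexOn.subset interior_subset hk.convexOn.1.interior
  have hfgrad : ∀ z ∈ interior (dom f), HasGradientAt (realValued f) (grad f z) z :=
    fun z hz => hf2.hasGradientAt isOpen_interior hz
  have hsub : ∀ z ∈ interior (dom f), ∀ u ∈ interior (dom f),
      realValued f z + inner ℝ (grad f z) (u - z) ≤ realValued f u :=
    fun z hz u hu => hfconv'.add_inner_le (hfgrad z hz) hz hu
  have hbmem := hmaps hy
  have hamem := hmaps hx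
  set a := grad f x with ha
  set b := grad f y with hb
  set D := realValued f x - realValued f y - inner ℝ b (x - y) with hD
  set w := b - a with hw
  set v : ℝ → EuclideanSpace ℝ (Fin d) := fun t => a + t • w with hv
  have hv0 : v 0 = a := by simp [hv]
  have hv1 : v 1 = b := by simp [hv, hw]
  have hvseg : ∀ t ∈ Icc (0 : ℝ) 1, v t ∈ segment ℝ a b := fun t ht => by
    rw [segment_eq_image']
    exact ⟨t, ht, rfl⟩
  have hvmem : ∀ t ∈ Icc (0 : ℝ) 1, v t ∈ interior (dom k) := fun t ht =>
    hk.convexOn.1.interior.segment_subset hamem hbmem (hvseg t ht)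
  have hvd : ∀ t, HasDerivAt v w t := fun t => hasDerivAt_add_smul a w t
  have hζd : ∀ t, HasDerivAt (fun s => Z (v s)) (Z' (v t) w) t := fun t =>
    (hZ' (v t)).comp_hasDerivAt t (hvd t)
  -- The regularization error `∇f(Z v) - v` is uniformly small on the segment.
  have hnear : ∀ t ∈ Icc (0 : ℝ) 1, ‖grad f (Z (v t)) - v t‖ < ρ := by
    intro t ht
    have hz := hZmem (v t)
    have hzeq := hZ (v t)
    set z := Z (v t)
    have h1 := hsub z hz x hx
    have h2 := hsub x hx z hz
    have h3 := hsub y hy z hz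
    have hgz : grad f z = v t - ε • (z - x) := by rw [← hzeq]; abel
    have h4 : inner ℝ (grad f z) (x - z) =
        ε * ‖z - x‖ ^ 2 - (1 - t) * inner ℝ a (z - x) - t * inner ℝ b (z - x) := by
      rw [hgz, ← neg_sub z x, inner_neg_right, inner_sub_left, real_inner_smul_left,
        real_inner_self_eq_norm_sq]
      simp only [hv, hw, inner_add_left, inner_sub_left, real_inner_smul_left]
      ring
    have h5 : inner ℝ b (z - y) = inner ℝ b (z - x) + inner ℝ b (x - y) := by
      rw [← inner_add_right]; congr 1; abel
    rw [← ha] at h2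
    rw [← hb, h5] at h3
    have hD0 : 0 ≤ D := by
      have := hsub y hy x hx
      rw [hD]
      linarith
    have h6 : ε * ‖z - x‖ ^ 2 ≤ t * D := by
      rw [h4] at h1
      nlinarith [mul_le_mul_of_nonneg_left h2 (sub_nonneg.2 ht.2),
        mul_le_mul_of_nonneg_left h3 ht.1]
    have h7 : ε * ‖z - x‖ ^ 2 ≤ D := h6.trans (mul_le_of_le_one_left hD0 ht.2)
    have h8 : ‖grad f z - v t‖ = ε * ‖z - x‖ := by
      rw [hgz, sub_sub_cancel_left, norm_neg, norm_smul, Real.norm_of_nonneg hε.le]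
    rw [h8]
    refine lt_of_pow_lt_pow_left₀ 2 hρ.le ?_
    nlinarith [mul_le_mul_of_nonneg_left h7 hε.le]
  set M := L + ε * β with hM
  have hM0 : 0 ≤ M := by positivity
  -- `G` is the regularized conjugate of `f` along the segment.
  set G : ℝ → ℝ := fun t =>
    inner ℝ (v t) (Z (v t)) - realValued f (Z (v t)) - ε / 2 * ‖Z (v t) - x‖ ^ 2 with hG
  have hGd : ∀ t, HasDerivAt G (inner ℝ (Z (v t)) w) t := fun t => by
    have h1 := (hvd t).inner ℝ (hζd t)
    have h2 := (hfgrad _ (hZmem (v t))).comp_hasDerivAt (c := fun s => Z (v s)) (hζd t)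
    have h3 := (hasGradientAt_quadratic ε 0 x (Z (v t))).comp_hasDerivAt
      (c := fun s => Z (v s)) (hζd t)
    simp only [inner_zero_left, sub_zero] at h3
    refine ((h1.sub h2).sub h3).congr_deriv ?_
    have h4 : inner ℝ (v t) (Z' (v t) w) =
        inner ℝ (grad f (Z (v t)) + ε • (Z (v t) - x)) (Z' (v t) w) := by rw [hZ]
    rw [h4, inner_add_left, real_inner_comm w]
    ring
  have hψ : ConvexOn ℝ (Icc (0 : ℝ) 1)
      (fun t => M * G t - realValued k (v t) + δ / 2 * ‖w‖ ^ 2 * t ^ 2) := by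
    have hd1 : ∀ t ∈ Icc (0 : ℝ) 1,
        HasDerivAt (fun t => M * G t - realValued k (v t) + δ / 2 * ‖w‖ ^ 2 * t ^ 2)
          (M * inner ℝ (Z (v t)) w - inner ℝ (grad k (v t)) w + δ * ‖w‖ ^ 2 * t) t := by
      intro t ht
      have h1 := HasGradientAt.comp_hasDerivAt
        (hk2.hasGradientAt isOpen_interior (hvmem t ht)) (hvd t)
      refine ((((hGd t).const_mul M).sub h1).add
        ((hasDerivAt_pow 2 t).const_mul (δ / 2 * ‖w‖ ^ 2))).congr_deriv ?_
      simp only [grad]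
      push_cast
      ring
    have hd2 : ∀ t ∈ Icc (0 : ℝ) 1, HasDerivAt
        (fun t => M * inner ℝ (Z (v t)) w - inner ℝ (grad k (v t)) w + δ * ‖w‖ ^ 2 * t)
        (M * inner ℝ (Z' (v t) w) w - inner ℝ (hess k (v t) w) w + δ * ‖w‖ ^ 2) t := by
      intro t ht
      have h1 : HasDerivAt (fun s => grad k (v s)) (hess k (v t) w) t :=
        (hk2.hasFDerivAt_gradient isOpen_interior (hvmem t ht)).comp_hasDerivAt t (hvd t)
      have h2 := (hζd t).inner ℝ (hasDerivAt_const t w)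
      have h3 := h1.inner ℝ (hasDerivAt_const t w)
      refine (((h2.const_mul M).sub h3).add
        ((hasDerivAt_id t).const_mul (δ * ‖w‖ ^ 2))).congr_deriv ?_
      simp
    refine convexOn_of_hasDerivWithinAt2_nonneg (convex_Icc 0 1)
      (fun t ht => (hd1 t ht).continuousAt.continuousWithinAt)
      (fun t ht => (hd1 t (interior_subset ht)).hasDerivWithinAt)
      (fun t ht => (hd2 t (interior_subset ht)).hasDerivWithinAt) fun t ht => ?_
    have ht' := interior_subset ht
    have hz := hZmem (v t)
    have hu := hmaps hz
    obtain ⟨h1, h2⟩ := hclose (v t) (hvseg t ht') _ (hnear t ht')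
    have h3 := inner_map_le_of_add_smul_eq
      (hf2.inner_fderiv_gradient_comm isOpen_interior hz)
      (hfconv'.inner_fderiv_gradient_nonneg hf2 isOpen_interior hz)
      (hk2.inner_fderiv_gradient_comm isOpen_interior hu)
      (hkconv'.inner_fderiv_gradient_nonneg hk2 isOpen_interior hu)
      (hle _ hz) hL hε.le h2 (hZH (v t) w)
    have h3' : inner ℝ (hess k (grad f (Z (v t))) w) w ≤ M * inner ℝ (Z' (v t) w) w := h3
    have h4 : inner ℝ ((hess k (v t) - hess k (grad f (Z (v t)))) w) w ≤ δ * ‖w‖ ^ 2 := by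
      refine (real_inner_le_norm _ _).trans ?_
      rw [pow_two, ← mul_assoc]
      gcongr
      exact ContinuousLinearMap.le_of_opNorm_le _ h1 w
    rw [sub_apply, inner_sub_left] at h4
    linarith
  have hψ0 : HasDerivAt (fun t => M * G t - realValued k (v t) + δ / 2 * ‖w‖ ^ 2 * t ^ 2)
      (M * inner ℝ x w - inner ℝ (grad k a) w) 0 := by
    have h1 := HasGradientAt.comp_hasDerivAt
      (hk2.hasGradientAt isOpen_interior (hvmem 0 (by simp))) (hvd 0)
    refine ((((hGd 0).const_mul M).sub h1).add
      ((hasDerivAt_pow 2 (0 : ℝ)).const_mul (δ / 2 * ‖w‖ ^ 2))).congr_deriv ?_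
    simp [hv0, hZx, grad]
  have hslope := hψ.le_slope_of_hasDerivAt (x := 0) (y := 1) (by simp) (by simp) one_pos hψ0
  simp only [slope_def_field, sub_zero, div_one, hv0, hv1, one_pow, mul_one] at hslope
  have hG0 : G 0 = inner ℝ a x - realValued f x := by simp [hG, hv0, hZx]
  -- Fenchel's inequality bounds the regularized conjugate by the conjugate of `f` at `b`.
  have hG1 : G 1 ≤ inner ℝ b y - realValued f y := by
    have h1 := hsub y hy (Z b) (hZmem b)
    rw [← hb, inner_sub_right] at h1
    have h2 : 0 ≤ ε / 2 * ‖Z b - x‖ ^ 2 := by positivity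
    simp only [hG, hv1]
    linarith
  have hGD : G 1 - G 0 - inner ℝ x w ≤ D := by
    rw [hG0, hD, hw, inner_sub_right, inner_sub_right, real_inner_comm b x, real_inner_comm a x]
    linarith
  have := mul_le_mul_of_nonneg_left hGD hM0
  linarith

/-- The real-valued form of the inequality: the regularization is removed in the limit. -/
theorem bregman_real_le {L : ℝ} (hf : EssentiallySmooth f)
    (hf2 : ContDiffOn ℝ 2 (realValued f) (interior (dom f))) (hk : ProperClosedConvex k)
    (hk2 : ContDiffOn ℝ 2 (realValued k) (interior (dom k)))
    (hmaps : MapsTo (grad f) (interior (dom f)) (interior (dom k)))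
    (hle : ∀ z ∈ interior (dom f), ∀ u,
      inner ℝ (hess f z (hess k (grad f z) u)) (hess k (grad f z) u) ≤
        L * inner ℝ (hess k (grad f z) u) u)
    (hx : x ∈ interior (dom f)) (hy : y ∈ interior (dom f)) (hL : 0 ≤ L) :
    realValued k (grad f y) - realValued k (grad f x) -
        inner ℝ (grad k (grad f x)) (grad f y - grad f x) ≤
      L * (realValued f x - realValued f y - inner ℝ (grad f y) (x - y)) := by
  set D := realValued f x - realValued f y - inner ℝ (grad f y) (x - y) with hD
  have hcompact : IsCompact (segment ℝ (grad f x) (grad f y)) := by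
    rw [segment_eq_image']
    exact isCompact_Icc.image (by fun_prop)
  have hcont : ∀ v ∈ segment ℝ (grad f x) (grad f y), ContinuousAt (hess k) v := fun v hv =>
    hk2.continuousAt_fderiv_gradient isOpen_interior
      (hk.convexOn.1.interior.segment_subset (hmaps hx) (hmaps hy) hv)
  obtain ⟨β₀, hβ₀⟩ := hcompact.exists_bound_of_continuousOn
    (f := hess k) fun v hv => (hcont v hv).continuousWithinAt
  have hβ₀0 : 0 ≤ β₀ := (norm_nonneg _).trans (hβ₀ _ (left_mem_segment ℝ _ _))
  have hmain : ∀ δ : ℝ, 0 < δ → realValued k (grad f y) - realValued k (grad f x) -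
        inner ℝ (grad k (grad f x)) (grad f y - grad f x) ≤
      L * D + δ / 2 * ‖grad f y - grad f x‖ ^ 2 := by
    intro δ hδ
    obtain ⟨ρ, hρ, hclose⟩ := Metric.mem_uniformity_dist.1
      (hcompact.uniformContinuousAt_of_continuousAt (hess k) hcont (Metric.dist_mem_uniformity hδ))
    have hev : ∀ᶠ ε in 𝓝[>] (0 : ℝ), ε * D < ρ ^ 2 := by
      have h1 : Tendsto (fun ε : ℝ => ε * D) (𝓝[>] 0) (𝓝 (0 * D)) :=
        (tendsto_id.mul_const D).mono_left nhdsWithin_le_nhds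
      exact h1.eventually_lt_const (by rw [zero_mul]; positivity)
    have hlim : Tendsto (fun ε : ℝ => (L + ε * (β₀ + δ)) * D +
        δ / 2 * ‖grad f y - grad f x‖ ^ 2) (𝓝[>] 0)
        (𝓝 ((L + 0 * (β₀ + δ)) * D + δ / 2 * ‖grad f y - grad f x‖ ^ 2)) :=
      Tendsto.mono_left (Continuous.tendsto (by fun_prop) 0) nhdsWithin_le_nhds
    rw [zero_mul, add_zero] at hlim
    refine ge_of_tendsto hlim ?_
    filter_upwards [hev, self_mem_nhdsWithin] with ε hερ hε
    refine bregman_le_add_of_hess_close hf hf2 hk hk2 hmaps hle hx hy hL hε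
      (by positivity) hρ (fun v hv u huv => ?_) hερ
    have h1 : dist (hess k v) (hess k u) < δ :=
      hclose (a := v) (b := u) (by rwa [dist_comm, dist_eq_norm]) hv
    rw [dist_eq_norm] at h1
    refine ⟨h1.le, ?_⟩
    have h2 := norm_sub_norm_le (hess k u) (hess k v)
    rw [norm_sub_rev] at h2
    linarith [hβ₀ v hv]
  have hlim : Tendsto (fun δ : ℝ => L * D + δ / 2 * ‖grad f y - grad f x‖ ^ 2) (𝓝[>] 0)
      (𝓝 (L * D + 0 / 2 * ‖grad f y - grad f x‖ ^ 2)) :=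
    Tendsto.mono_left (Continuous.tendsto (by fun_prop) 0) nhdsWithin_le_nhds
  rw [zero_div, zero_mul, add_zero] at hlim
  exact ge_of_tendsto hlim (by filter_upwards [self_mem_nhdsWithin] with δ hδ using hmain δ hδ)

end Bregman

end DualPrecond

theorem mainTheorem5 {d : ℕ} (f k : EuclideanSpace ℝ (Fin d) → EReal) (L : ℝ)
    (hf : DualPrecond.EssentiallySmooth f)
    (hf2 : ContDiffOn ℝ 2 (DualPrecond.realValued f) (interior (DualPrecond.dom f)))
    (hk : DualPrecond.LegendreConvex k)
    (hk2 : ContDiffOn ℝ 2 (DualPrecond.realValued k) (interior (DualPrecond.dom k)))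
    (hmaps : Set.MapsTo (DualPrecond.grad f)
      (interior (DualPrecond.dom f)) (interior (DualPrecond.dom k)))
    (hdet : ∀ w ∈ interior (DualPrecond.dom k), (DualPrecond.hess k w).det ≠ 0)
    (hle : ∀ x ∈ interior (DualPrecond.dom f),
      DualPrecond.hess f x ≤ L • (DualPrecond.hess k (DualPrecond.grad f x)).inverse) :
    ∀ x ∈ interior (DualPrecond.dom f), ∀ y ∈ interior (DualPrecond.dom f),
      DualPrecond.bregman k (DualPrecond.grad f y) (DualPrecond.grad f x) ≤
        (L : EReal) * DualPrecond.bregman f x y := by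
  intro x hx y hy
  have hfp := hf.toProperClosedConvex
  have hkp := hk.toProperClosedConvex
  rw [hkp.bregman_eq (interior_subset (hmaps hy)) (hmaps hx) (hk.differentiable _ (hmaps hx)),
    hfp.bregman_eq (interior_subset hx) hy (hf.differentiable y hy), ← EReal.coe_mul,
    EReal.coe_le_coe_iff]
  have hAB : ∀ z ∈ interior (DualPrecond.dom f), ∀ u,
      inner ℝ (DualPrecond.hess f z (DualPrecond.hess k (DualPrecond.grad f z) u))
        (DualPrecond.hess k (DualPrecond.grad f z) u) ≤
        L * inner ℝ (DualPrecond.hess k (DualPrecond.grad f z) u) u := by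
    intro z hz u
    set B := DualPrecond.hess k (DualPrecond.grad f z) with hB
    have hBinv : B.IsInvertible :=
      ⟨_, B.coe_toContinuousLinearEquivOfDetNeZero (hdet _ (hmaps hz))⟩
    have hinv : B.inverse (B u) = u := hBinv.inverse_apply_eq.2 rfl
    have h1 := ((ContinuousLinearMap.le_def _ _).1 (hle z hz)).inner_nonneg_left (B u)
    rw [sub_apply, smul_apply, ← hB, hinv, inner_sub_left,
      real_inner_smul_left, real_inner_comm] at h1
    linarith
  rcases eq_or_ne x y with rfl | hne
  · simp
  refine DualPrecond.bregman_real_le hf hf2 hkp hk2 hmaps hAB hx hy ?_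
  -- In positive dimension the Hessian bound forces `0 ≤ L`.
  set B := DualPrecond.hess k (DualPrecond.grad f x) with hB
  set u := x - y with hu
  have hfc := hfp.convexOn.subset interior_subset hfp.convexOn.1.interior
  have hkc := hkp.convexOn.subset interior_subset hkp.convexOn.1.interior
  have hApos : 0 ≤ inner ℝ (DualPrecond.hess f x (B u)) (B u) :=
    hfc.inner_fderiv_gradient_nonneg hf2 isOpen_interior hx (B u)
  have hBne : B u ≠ 0 := by
    rw [← B.toContinuousLinearEquivOfDetNeZero_apply (hdet _ (hmaps hx)) u, Ne,
      ContinuousLinearEquiv.map_eq_zero_iff]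
    exact sub_ne_zero.2 hne
  have hBpos : 0 < inner ℝ (B u) u := by
    have h1 := DualPrecond.sq_norm_map_le
      (hk2.inner_fderiv_gradient_comm isOpen_interior (hmaps hx))
      (hkc.inner_fderiv_gradient_nonneg hk2 isOpen_interior (hmaps hx)) u
    have h2 : 0 < ‖B u‖ ^ 2 := by positivity
    exact pos_of_mul_pos_right (h2.trans_le h1) (norm_nonneg _)
  exact nonneg_of_mul_nonneg_left (hApos.trans (hAB x hx u)) hBpos
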